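/- Let $\Pi$ be a finite projective plane of order $q$, with point set $\mathcal P$ and line set $\mathcal L$ (not necessarily coordinatized by a field), and let $G(\Pi)$ be its incidence graph: the bipartite graph on the disjoint union $\mathcal P\sqcup\mathcal L$ in which a point and a line are adjacent if and only if they are incident. For a connected graph $G$, a vertex $v$ and a nonempty set $S$ of vertices, let $d(v,S)=\min_{x\in S}d(v,x)$. An ordered partition $(S_1,\dots,S_k)$ of $V(G)$ into nonempty classes is called resolving if the vectors $(d(v,S_1),\dots,d(v,S_k))$, $v\in V(G)$, are pairwise distinct, and the partition dimension $\mathrm{pd}(G)$ is the least $k$ for which a resolving partition with $k$ classes exists. Then $\mathrm{pd}(G(\Pi))\le(4+o(1))\log_2 q$ as $q\to\infty$, uniformly over all projective planes of order $q$; that is, there is a function $\varepsilon:\mathbb N\to\mathbb R$ with $\varepsilon(q)\to0$ as $q\to\infty$ such that $\mathrm{pd}(G(\Pi))\le(4+\varepsilon(q))\log_2 q$ for every finite projective plane $\Pi$ of order $q$. More explicitly, there is an absolute constant $q_0$ such that $\mathrm{pd}(G(\Pi))\le 4\lceil\log_2 q\rceil+5$ for every finite projective plane $\Pi$ of order $q\ge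 q_0$. -/

import Mathlib

universe u v

/-- The distance `d(v, S)` from a vertex `v` to a set `S` of vertices: the least distance from `v`
to an element of `S` (infinite if no element of `S` can be reached from `v`). -/
noncomputable def SimpleGraph.distToSet {V : Type*} (G : SimpleGraph V) (v : V) (S : Set V) : ℕ∞ :=
  ⨅ x ∈ S, G.edist v x

/-- The representation `r(v | S) = (d(v, S₁), …, d(v, Sₖ))` of a vertex `v` with respect to an
ordered family `S` of vertex sets. -/
noncomputable def SimpleGraph.representation {V : Type*} (G : SimpleGraph V) {k : ℕ}
    (S : Fin k → Set V) (v : V) : Fin k → ℕ∞ :=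
  fun i => G.distToSet v (S i)

/-- The ordered family `S₁, …, Sₖ` is a resolving partition of the vertex set of `G`: the classes
are nonempty, pairwise disjoint, cover all vertices, and distinct vertices have distinct
representations. -/
structure SimpleGraph.IsResolvingPartition {V : Type*} (G : SimpleGraph V) {k : ℕ}
    (S : Fin k → Set V) : Prop where
  nonempty : ∀ i, (S i).Nonempty
  disjoint : ∀ i j, i ≠ j → Disjoint (S i) (S j)
  cover : ⋃ i, S i = Set.univ
  separates : Function.Injective (G.representation S)

/-- The partition dimension of `G`: the least `k` for which there is a resolving `k`-partition. -/
noncomputable def SimpleGraph.partitionDimension {V : Type*} (G : SimpleGraph V) : ℕ :=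
  sInf {k : ℕ | ∃ S : Fin k → Set V, G.IsResolvingPartition S}

/-- For a finite graph the partition dimension is attained (the partition into singletons is
resolving, so the infimum in its definition is a minimum). -/
theorem SimpleGraph.exists_isResolvingPartition_partitionDimension {V : Type*} [Finite V]
    (G : SimpleGraph V) :
    ∃ S : Fin G.partitionDimension → Set V, G.IsResolvingPartition S := by
  have h : {k : ℕ | ∃ S : Fin k → Set V, G.IsResolvingPartition S}.Nonempty := by
    obtain ⟨n, ⟨e⟩⟩ := Finite.exists_equiv_fin V
    refine ⟨n, fun i => {e.symm i}, ⟨fun i => Set.singleton_nonempty _, ?_, ?_, ?_⟩⟩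
    · intro i j hij
      simpa using hij
    · ext v
      simp only [Set.mem_iUnion, Set.mem_singleton_iff, Set.mem_univ, iff_true]
      exact ⟨e v, by simp⟩
    · intro v w hvw
      have h1 := congrFun hvw (e v)
      simp only [representation, distToSet, Set.mem_singleton_iff, iInf_iInf_eq_left,
        Equiv.symm_apply_apply, edist_self] at h1
      exact (edist_eq_zero_iff.mp h1.symm).symm
  exact Nat.sInf_mem h

/-- The incidence graph of a configuration with points `P` and lines `L`: the bipartite graph on
the disjoint union of `P` and `L` in which a point and a line are adjacent when they are
incident. -/
def Configuration.incidenceGraph (P L : Type*) [Membership P L] : SimpleGraph (P ⊕ L) where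
  Adj
    | Sum.inl p, Sum.inr l => p ∈ l
    | Sum.inr l, Sum.inl p => p ∈ l
    | _, _ => False
  symm := ⟨by rintro (p | l) (q | m) h <;> exact h⟩
  loopless := ⟨by rintro (p | l) h <;> exact h⟩

/-! Colour the vertices independently and uniformly with `M` colours, where `M` makes a fixed colour
miss a set of `q` vertices with probability about 1/2. Keep `k = 4⌈log₂ q⌉ + 4` colours as classes
and merge the others into one more class. Two vertices `v ≠ w` have at most one common neighbour, so
`v` has `q` neighbours not adjacent to `w`. Fix all colours outside these. If no class separates `v`
from `w`, then for all but two kept colours it is forced whether the colour occurs among the `q`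
neighbours. Occurrences of different colours are negatively correlated (`card_filter_avoid_hit_le`),
so this has probability at most `6 / 2 ^ k` (`sub_pow_mul_one_sub_pow_le`). There are about `4 q ^
4` ordered pairs and `2 ^ k ≥ 16 q ^ 4`, so on average fewer than two ordered pairs are unseparated.
Such pairs come in twos, hence some colouring has none. -/

open Finset

/-! ### Distances to sets and colourings. -/

namespace SimpleGraph

variable {V : Type*} (G : SimpleGraph V)

theorem distToSet_lt_one_iff {v : V} {S : Set V} : G.distToSet v S < 1 ↔ v ∈ S := by
  simp only [distToSet, iInf_lt_iff]
  simp only [Order.lt_one_iff, edist_eq_zero_iff]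
  constructor
  · rintro ⟨x, hx, rfl⟩
    exact hx
  · exact fun h => ⟨v, h, rfl⟩

theorem distToSet_lt_two_iff {v : V} {S : Set V} :
    G.distToSet v S < 2 ↔ v ∈ S ∨ ∃ w ∈ S, G.Adj v w := by
  have key : ∀ x : V, G.edist v x < 2 ↔ G.Adj v x ∨ v = x := by
    intro x
    rw [← edist_le_one_iff_adj_or_eq, ← one_add_one_eq_two, ENat.lt_add_one_iff ENat.one_ne_top]
  simp only [distToSet, iInf_lt_iff, key]
  constructor
  · rintro ⟨x, hx, h | rfl⟩
    · exact Or.inr ⟨x, hx, h⟩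
    · exact Or.inl hx
  · rintro (h | ⟨w, hw, h⟩)
    · exact ⟨v, h, Or.inr rfl⟩
    · exact ⟨w, hw, Or.inl h⟩

/-- A colouring whose (possibly empty) colour classes separate vertices by distances bounds the
partition dimension by the number of colours. -/
theorem partitionDimension_le_card_of_coloring {α : Type*} [Fintype α] (f : V → α)
    (hf : Function.Injective fun v a => G.distToSet v (f ⁻¹' {a})) :
    G.partitionDimension ≤ Fintype.card α := by
  classical
  have e : Set.range f ≃ Fin (Nat.card (Set.range f)) := Finite.equivFin _
  have hle : Nat.card (Set.range f) ≤ Fintype.card α := by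
    rw [← Nat.card_eq_fintype_card]
    exact Nat.card_le_card_of_injective _ Subtype.val_injective
  refine le_trans (Nat.sInf_le ⟨fun i => f ⁻¹' {(e.symm i : α)}, ?_, ?_, ?_, ?_⟩) hle
  · intro i
    obtain ⟨v, hv⟩ := (e.symm i).2
    exact ⟨v, hv⟩
  · intro i j hij
    refine Disjoint.preimage f (Set.disjoint_singleton.2 fun h => hij ?_)
    exact e.symm.injective (Subtype.ext h)
  · refine Set.eq_univ_of_forall fun v => Set.mem_iUnion.2 ⟨e ⟨f v, v, rfl⟩, ?_⟩
    exact (congrArg Subtype.val (e.symm_apply_apply ⟨f v, v, rfl⟩)).symm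
  · intro v w hvw
    refine hf (funext fun a => ?_)
    by_cases ha : a ∈ Set.range f
    · have := congrFun hvw (e ⟨a, ha⟩)
      simp only [representation] at this
      rwa [congrArg Subtype.val (e.symm_apply_apply ⟨a, ha⟩)] at this
    -- An unused colour is at distance `⊤` from every vertex, so it separates nothing.
    · have : f ⁻¹' {a} = ∅ := by
        ext x
        simpa using fun h => ha ⟨x, h⟩
      simp [this, distToSet]

/-- A set at equal distance from two vertices outside it meets both neighbourhoods or neither. -/
theorem exists_adj_iff_of_distToSet_eq {S : Set V} {v w : V}
    (h : G.distToSet v S = G.distToSet w S) (hv : v ∉ S) :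
    (∃ u ∈ S, G.Adj v u) ↔ ∃ u ∈ S, G.Adj w u := by
  have h1 : w ∉ S := by rwa [← G.distToSet_lt_one_iff, ← h, G.distToSet_lt_one_iff]
  have h2 : G.distToSet v S < 2 ↔ G.distToSet w S < 2 := by rw [h]
  simpa only [distToSet_lt_two_iff, hv, h1, false_or] using h2

end SimpleGraph

/-! ### Counting maps that avoid some colours and hit others. -/

/-- The base on the right equals `b + (1 - b) / y`, and the left side is `y` times the two leading
terms of its binomial expansion. This is the induction step of `card_filter_avoid_hit_le`. -/
theorem mul_pow_add_mul_pow_le {y b : ℝ} {t : ℕ} (hy : 0 < y) (hb : 0 ≤ b) (hb1 : b ≤ 1) :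
    t * b ^ (t - 1) + (y - t) * b ^ t ≤ y * (1 - (1 - 1 / y) * (1 - b)) ^ t := by
  rcases Nat.eq_zero_or_pos t with rfl | ht
  · simp
  set d := (1 - b) / y with hd
  have hd0 : 0 ≤ d := div_nonneg (by linarith) hy.le
  have e1 : 1 - (1 - 1 / y) * (1 - b) = b + d := by rw [hd]; field_simp; ring
  have e2 : y * d = 1 - b := by rw [hd]; field_simp
  have key : b ^ t + t * b ^ (t - 1) * d ≤ (b + d) ^ t := by
    rw [add_pow, ← Nat.sub_add_cancel ht, sum_range_succ, sum_range_succ]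
    have : 0 ≤ ∑ x ∈ range (t - 1), b ^ x * d ^ (t - 1 + 1 - x) * ((t - 1 + 1).choose x : ℝ) :=
      sum_nonneg fun _ _ => by positivity
    simp only [Nat.add_sub_cancel, Nat.choose_self, Nat.add_sub_cancel_left, pow_one,
      Nat.choose_succ_self_right, tsub_self, pow_zero]
    push_cast
    nlinarith
  have e3 : b ^ t = b ^ (t - 1) * b := by rw [← pow_succ, Nat.sub_add_cancel ht]
  rw [e1]
  calc _ = y * (b ^ t + t * b ^ (t - 1) * d) := by
        rw [mul_add, show y * (t * b ^ (t - 1) * d) = t * b ^ (t - 1) * (y * d) by ring, e2, e3]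
        ring
    _ ≤ _ := mul_le_mul_of_nonneg_left key hy.le

/-- The number of functions avoiding the colours in `Z` and attaining all colours in `T` is at most
what independence of the hitting events would give. -/
theorem card_filter_avoid_hit_le {K : Type*} [Fintype K] [DecidableEq K] (Z : Finset K) (y : ℕ)
    (hy : 0 < y) (hZ : y + #Z = Fintype.card K) (n : ℕ) :
    ∀ T : Finset K, Disjoint Z T →
    (#{h : Fin n → K | (∀ i, h i ∉ Z) ∧ ∀ c ∈ T, ∃ i, h i = c} : ℝ) ≤
      y ^ n * (1 - (1 - 1 / (y : ℝ)) ^ n) ^ #T := by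
  have hyR : (0 : ℝ) < y := by exact_mod_cast hy
  have hy1 : (1 : ℝ) ≤ y := by exact_mod_cast hy
  have hx0 : (0 : ℝ) ≤ 1 - 1 / (y : ℝ) := by
    rw [sub_nonneg, div_le_one hyR]; exact hy1
  have hx1 : 1 - 1 / (y : ℝ) ≤ 1 := by
    have : 0 ≤ 1 / (y : ℝ) := by positivity
    linarith
  induction n with
  | zero =>
    intro T _
    rcases T.eq_empty_or_nonempty with rfl | ⟨c, hc⟩
    · simp
    · rw [filter_false_of_mem]
      · simp
      · rintro h - ⟨-, h2⟩
        obtain ⟨i, -⟩ := h2 c hc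
        exact i.elim0
  | succ n ih =>
    intro T hT
    set b : ℝ := 1 - (1 - 1 / (y : ℝ)) ^ n with hb
    have hb0 : 0 ≤ b := sub_nonneg.2 (pow_le_one₀ hx0 hx1)
    have hb1 : b ≤ 1 := by have := pow_nonneg hx0 n; linarith
    -- Split by the first value `c`: the tail must still hit `T.erase c`, which is smaller than `T`
    -- for `#T` of the `y` choices.
    have hsub : ({h : Fin (n + 1) → K | (∀ i, h i ∉ Z) ∧ ∀ c ∈ T, ∃ i, h i = c} : Finset _) ⊆
        (Zᶜ).biUnion fun c => image (fun h : Fin n → K => (Fin.cons c h : Fin (n + 1) → K))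
          {h : Fin n → K | (∀ i, h i ∉ Z) ∧ ∀ c' ∈ T.erase c, ∃ i, h i = c'} := by
      intro h hh
      obtain ⟨-, h1, h2⟩ := mem_filter.1 hh
      refine mem_biUnion.2 ⟨h 0, mem_compl.2 (h1 0), mem_image.2 ⟨Fin.tail h,
        mem_filter.2 ⟨mem_univ _, fun i => h1 _, fun c hc => ?_⟩, Fin.cons_self_tail h⟩⟩
      obtain ⟨i, hi⟩ := h2 c (mem_of_mem_erase hc)
      rcases Fin.eq_zero_or_eq_succ i with rfl | ⟨j, rfl⟩
      · exact absurd hi.symm (ne_of_mem_erase hc)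
      · exact ⟨j, hi⟩
    have hTZ : T ⊆ Zᶜ := fun c hc => mem_compl.2 fun h => (disjoint_left.1 hT h) hc
    have hcard : #(Zᶜ) = y := by rw [card_compl]; omega
    have hcard2 : (#(Zᶜ \ T) : ℝ) = y - #T := by
      rw [card_sdiff_of_subset hTZ, Nat.cast_sub (card_le_card hTZ), hcard]
    calc (#{h : Fin (n + 1) → K | (∀ i, h i ∉ Z) ∧ ∀ c ∈ T, ∃ i, h i = c} : ℝ)
        ≤ ∑ c ∈ Zᶜ, (y ^ n * b ^ #(T.erase c) : ℝ) := by
          refine le_trans (Nat.cast_le.2 ((card_le_card hsub).trans card_biUnion_le)) ?_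
          rw [Nat.cast_sum]
          refine sum_le_sum fun c _ => le_trans (Nat.cast_le.2 card_image_le) (ih _ ?_)
          exact hT.mono_right (erase_subset _ _)
      _ = y ^ n * (#T * b ^ (#T - 1) + (y - #T) * b ^ #T) := by
          rw [← sum_sdiff hTZ, sum_congr rfl fun c hc => by
            rw [erase_eq_of_notMem (mem_sdiff.1 hc).2],
            sum_congr (s₁ := T) rfl fun c hc => by rw [card_erase_of_mem hc]]
          simp only [sum_const, nsmul_eq_mul, hcard2]
          ring
      _ ≤ y ^ n * (y * (1 - (1 - 1 / y) * (1 - b)) ^ #T) :=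
          mul_le_mul_of_nonneg_left (mul_pow_add_mul_pow_le hyR hb0 hb1) (by positivity)
      _ = _ := by rw [hb, pow_succ, pow_succ (1 - 1 / (y : ℝ))]; ring

/-! ### The first moment argument. -/

namespace SimpleGraph

variable {V : Type*} [Fintype V] [DecidableEq V] (G : SimpleGraph V)

/-- The number of colourings for which the neighbourhoods of `v` and `w` meet the same colours
among those in `Act`, up to the colour of `v`. -/
theorem card_colorings_not_separating_le {K : Type*} [Fintype K] [DecidableEq K] (Act : Finset K)
    {q : ℕ} {c : ℝ} (hAct : #Act < Fintype.card K)
    (hc : ∀ s t : ℕ, #Act ≤ s + t + 2 → s + t ≤ #Act →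
      ((Fintype.card K - s : ℕ) : ℝ) ^ q * (1 - (1 - 1 / ((Fintype.card K - s : ℕ) : ℝ)) ^ q) ^ t ≤
        c * (Fintype.card K : ℝ) ^ q)
    {v w z : V} {A : Finset V} (hA : #A = q) (hz : z ∉ A)
    (hAv : ∀ u ∈ A, G.Adj v u) (hAw : ∀ u ∈ A, ¬ G.Adj w u)
    (hv : ∀ u, G.Adj v u → u ∈ A ∨ u = z) (B : Finset (V → K))
    (hB : ∀ f ∈ B, ∀ i ∈ Act, i ≠ f v →
      ((∃ u, G.Adj v u ∧ f u = i) ↔ ∃ u, G.Adj w u ∧ f u = i)) :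
    (#B : ℝ) ≤ c * (Fintype.card K : ℝ) ^ Fintype.card V := by
  classical
  have hvA : v ∉ A := fun h => G.irrefl (hAv v h)
  let e : Fin q ≃ A := (A.equivFinOfCardEq hA).symm
  let ρ : (V → K) → ({u // u ∉ A} → K) := fun f u => f u
  have hfib : ∀ g : {u // u ∉ A} → K,
      (#{f ∈ B | ρ f = g} : ℝ) ≤ c * (Fintype.card K : ℝ) ^ q := by
    intro g
    -- The colour of `v` is exempt in `hB`, and `v` sees the colour of `z` whatever happens on `A`.
    -- Both are dropped, hence the slack 2 in `hc`.
    let R : Finset K := Act \ {g ⟨v, hvA⟩, g ⟨z, hz⟩}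
    -- No neighbour of `w` lies in `A`, so the colours seen by `w` depend on `g` alone: on `A`,
    -- those in `T` must occur and those in `R \ T` must not.
    let T : Finset K := {i ∈ R | ∃ u : {u // u ∉ A}, G.Adj w u ∧ g u = i}
    have hTR : T ⊆ R := filter_subset _ _
    have hR1 : #R ≤ #Act := card_le_card sdiff_subset
    have hR2 : #Act ≤ #R + 2 :=
      card_le_card_sdiff_add_card.trans (Nat.add_le_add_left card_le_two _)
    have hRT : #(R \ T) + #T = #R := card_sdiff_add_card_eq_card hTR
    have hinj : #{f ∈ B | ρ f = g} ≤
        #{h : Fin q → K | (∀ i, h i ∉ R \ T) ∧ ∀ c ∈ T, ∃ i, h i = c} := by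
      refine card_le_card_of_injOn (fun f i => f (e i)) ?_ ?_
      · intro f hf
        obtain ⟨hfB, rfl⟩ := mem_filter.1 hf
        have hsep : ∀ i ∈ R, ((∃ u ∈ A, f u = i) ↔ i ∈ T) := by
          intro i hi
          obtain ⟨hiA, hne⟩ := mem_sdiff.1 hi
          simp only [mem_insert, mem_singleton, not_or] at hne
          have h1 := hB f hfB i hiA hne.1
          constructor
          · rintro ⟨u, hu, hui⟩
            obtain ⟨x, hx, hxi⟩ := h1.1 ⟨u, hAv u hu, hui⟩
            exact mem_filter.2 ⟨hi, ⟨x, fun h => hAw x h hx⟩, hx, hxi⟩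
          · intro hiT
            obtain ⟨-, x, hx, hxi⟩ := mem_filter.1 hiT
            obtain ⟨u, hu, hui⟩ := h1.2 ⟨x, hx, hxi⟩
            rcases hv u hu with h | rfl
            · exact ⟨u, h, hui⟩
            · exact absurd hui.symm hne.2
        refine mem_coe.2 (mem_filter.2 ⟨mem_univ _, fun i hi => ?_, fun i hi => ?_⟩)
        · obtain ⟨hiR, hiT⟩ := mem_sdiff.1 hi
          exact hiT ((hsep _ hiR).1 ⟨e i, (e i).2, rfl⟩)
        · obtain ⟨u, hu, hui⟩ := (hsep i (hTR hi)).2 hi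
          exact ⟨e.symm ⟨u, hu⟩, by simpa using hui⟩
      · intro f hf f' hf' hff
        have h1 := (mem_filter.1 hf).2.trans (mem_filter.1 hf').2.symm
        funext u
        by_cases hu : u ∈ A
        · simpa using congrFun hff (e.symm ⟨u, hu⟩)
        · exact congrFun h1 ⟨u, hu⟩
    refine (Nat.cast_le.2 hinj).trans ?_
    have hs : #(R \ T) < Fintype.card K := by omega
    exact (card_filter_avoid_hit_le (R \ T) (Fintype.card K - #(R \ T)) (by omega) (by omega) q T
      disjoint_sdiff.symm).trans (hc _ _ (by omega) (by omega))
  have hq : q ≤ Fintype.card V := hA ▸ card_le_univ A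
  rw [card_eq_sum_card_fiberwise (f := ρ) (t := univ) fun _ _ => mem_coe.2 (mem_univ _),
    Nat.cast_sum]
  refine (sum_le_sum fun g _ => hfib g).trans (le_of_eq ?_)
  rw [sum_const, nsmul_eq_mul, card_univ, Fintype.card_fun, Fintype.card_subtype_compl,
    Fintype.card_coe, hA, ← Nat.sub_add_cancel hq, pow_add]
  push_cast
  rw [Nat.add_sub_cancel]
  ring

/-- First moment bound for the partition dimension: colour the vertices uniformly with `M` colours
and merge all but `k` colour classes. -/
theorem partitionDimension_le_of_first_moment {q k M : ℕ} {c : ℝ} (hkM : k < M)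
    (hc : ∀ s t : ℕ, k ≤ s + t + 2 → s + t ≤ k →
      ((M - s : ℕ) : ℝ) ^ q * (1 - (1 - 1 / ((M - s : ℕ) : ℝ)) ^ q) ^ t ≤ c * (M : ℝ) ^ q)
    (hA : ∀ v w : V, v ≠ w → ∃ (A : Finset V) (z : V), #A = q ∧ z ∉ A ∧
      (∀ u ∈ A, G.Adj v u) ∧ (∀ u ∈ A, ¬ G.Adj w u) ∧ ∀ u, G.Adj v u → u ∈ A ∨ u = z)
    (hmean : (Fintype.card V : ℝ) ^ 2 * c < 2) :
    G.partitionDimension ≤ k + 1 := by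
  classical
  let Act : Finset (Fin M) := {i | (i : ℕ) < k}
  have hAct : #Act = k := by
    rw [Fin.card_filter_val_lt]; exact min_eq_right hkM.le
  let F : (V → Fin M) → V → Option Act := fun f u =>
    if h : f u ∈ Act then some ⟨f u, h⟩ else none
  have hF : ∀ f u (i : Act), F f u = some i ↔ f u = i := by
    intro f u i
    by_cases h : f u ∈ Act
    · simp [F, h, Subtype.ext_iff]
    · have : f u ≠ i := fun h' => h (h' ▸ i.2)
      simp [F, h, this]
  let D : (V → Fin M) → V → Option Act → ℕ∞ := fun f v a => G.distToSet v (F f ⁻¹' {a})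
  have hpair : ∀ p ∈ (univ : Finset V).offDiag,
      (#{f : V → Fin M | D f p.1 = D f p.2} : ℝ) ≤ c * (M : ℝ) ^ Fintype.card V := by
    rintro ⟨v, w⟩ hp
    obtain ⟨A, z, hAq, hz, h1, h2, h3⟩ := hA v w (mem_offDiag.1 hp).2.2
    have := G.card_colorings_not_separating_le Act (q := q) (c := c) (by simpa [hAct] using hkM)
      (by simpa only [hAct, Fintype.card_fin] using hc) hAq hz h1 h2 h3
      {f : V → Fin M | D f v = D f w} ?_
    · simpa only [Fintype.card_fin] using this
    · intro f hf i hi hne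
      have hd := congrFun (mem_filter.1 hf).2 (some ⟨i, hi⟩)
      have := G.exists_adj_iff_of_distToSet_eq hd (by
        simpa [hF] using hne.symm)
      simpa only [Set.mem_preimage, Set.mem_singleton_iff, hF, and_comm] using this
  obtain ⟨f, hf⟩ : ∃ f : V → Fin M, #{p ∈ (univ : Finset V).offDiag | D f p.1 = D f p.2} < 2 := by
    by_contra! hcon
    have hM : (0 : ℝ) < (M : ℝ) ^ Fintype.card V := by
      have : 0 < M := by omega
      positivity
    have e1 : ∑ f : V → Fin M, #{p ∈ (univ : Finset V).offDiag | D f p.1 = D f p.2} =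
        ∑ p ∈ (univ : Finset V).offDiag, #{f : V → Fin M | D f p.1 = D f p.2} := by
      simp only [card_filter]
      exact sum_comm
    have e2 : (M : ℝ) ^ Fintype.card V * 2 ≤
        ∑ p ∈ (univ : Finset V).offDiag, (#{f : V → Fin M | D f p.1 = D f p.2} : ℝ) := by
      rw [← Nat.cast_sum, ← e1, Nat.cast_sum]
      have := sum_le_sum (s := univ) fun f _ => (Nat.cast_le (α := ℝ)).2 (hcon f)
      simpa using this
    have hc0 : 0 ≤ c := by
      have h := hc k 0 (by omega) (by omega)
      rw [pow_zero, mul_one] at h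
      have hMq : (0 : ℝ) < (M : ℝ) ^ q := by
        have : 0 < M := by omega
        positivity
      exact nonneg_of_mul_nonneg_left ((by positivity : (0 : ℝ) ≤ _).trans h) hMq
    have e3 := e2.trans (sum_le_sum hpair)
    have e4 : (#((univ : Finset V).offDiag) : ℝ) ≤ (Fintype.card V : ℝ) ^ 2 := by
      have : #((univ : Finset V).offDiag) ≤ Fintype.card V ^ 2 := by
        rw [offDiag_card, card_univ, sq]; omega
      exact_mod_cast this
    rw [sum_const, nsmul_eq_mul] at e3
    have e5 := mul_le_mul_of_nonneg_right e4 (mul_nonneg hc0 hM.le)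
    nlinarith
  have hinj : Function.Injective (D f) := by
    intro v w hvw
    by_contra hne
    refine absurd hf (not_lt.2 ?_)
    -- An unseparated pair counts in both orders, so fewer than two means none.
    rw [← card_pair (show (v, w) ≠ (w, v) from fun h => hne (congrArg Prod.fst h))]
    refine card_le_card fun p hp => ?_
    rcases mem_insert.1 hp with rfl | hp
    · simp [hne, hvw]
    · rw [mem_singleton.1 hp]
      simp [Ne.symm hne, hvw]
  have := G.partitionDimension_le_card_of_coloring (F f) hinj
  rwa [Fintype.card_option, Fintype.card_coe, hAct] at this

end SimpleGraph

/-! ### Palette size and numerical estimates. -/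

/-- `M` is the last palette size for which a colour misses `q` vertices with probability at most
1/2. Since `1 + 1/M` is the inverse of `1 - 1/(M+1)`, Bernoulli's inequality gives `1 + q/M < 2`. -/
theorem exists_nat_half_between {q : ℕ} (hq : 0 < q) :
    ∃ M : ℕ, q ≤ M ∧ (1 - 1 / (M : ℝ)) ^ q ≤ 1 / 2 ∧ 1 / 2 < (1 - 1 / ((M : ℝ) + 1)) ^ q := by
  classical
  have hqR : (0 : ℝ) < q := by exact_mod_cast hq
  have hq1 : (1 : ℝ) ≤ q := by exact_mod_cast hq
  have hex : ∃ m : ℕ, (1 : ℝ) / 2 < (1 - 1 / ((m : ℝ) + 1)) ^ q := by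
    refine ⟨4 * q, ?_⟩
    push_cast
    have h1 : 1 / (4 * (q : ℝ) + 1) ≤ 1 / (4 * q) := one_div_le_one_div_of_le (by linarith)
      (by linarith)
    have h2 : 1 / (4 * (q : ℝ)) ≤ 1 := by rw [div_le_one (by linarith)]; linarith
    have h3 := one_add_mul_le_pow (a := -(1 / (4 * (q : ℝ) + 1))) (by linarith) q
    have h4 : (q : ℝ) * (1 / (4 * q)) = 1 / 4 := by field_simp
    have h5 := mul_le_mul_of_nonneg_left h1 hqR.le
    rw [← sub_eq_add_neg] at h3
    linarith
  have hM := Nat.find_spec hex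
  set M := Nat.find hex with hMdef
  have hM0 : M ≠ 0 := by
    intro h0
    rw [h0] at hM
    simp only [Nat.cast_zero, zero_add, div_one, sub_self, zero_pow hq.ne'] at hM
    linarith
  have hMR : (0 : ℝ) < M := by exact_mod_cast Nat.pos_of_ne_zero hM0
  refine ⟨M, ?_, ?_, hM⟩
  · have h1 := one_add_mul_le_pow (a := 1 / (M : ℝ)) (by linarith [one_div_pos.2 hMR]) q
    have h2 : (1 + 1 / (M : ℝ)) ^ q * (1 - 1 / ((M : ℝ) + 1)) ^ q = 1 := by
      rw [← mul_pow]
      have : (1 + 1 / (M : ℝ)) * (1 - 1 / ((M : ℝ) + 1)) = 1 := by field_simp; ring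
      rw [this, one_pow]
    have h3 : (1 + 1 / (M : ℝ)) ^ q < 2 := by
      have : 0 < (1 + 1 / (M : ℝ)) ^ q := by positivity
      nlinarith
    have h4 : (q : ℝ) * (1 / M) < 1 := by linarith
    rw [mul_one_div, div_lt_one hMR] at h4
    exact_mod_cast h4.le
  · have := Nat.find_min hex (m := M - 1) (by omega)
    have e : ((M - 1 : ℕ) : ℝ) + 1 = M := by
      rw [Nat.cast_sub (by omega), Nat.cast_one, sub_add_cancel]
    rw [e] at this
    exact not_lt.1 this

/-- Each of the `s` avoided colours costs a factor 1/2, and each of the `t` hit colours a factor `(1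
+ d) / 2` with `d = (k + 1) / (q - k)`. The 6 is 4, for the two lost colours, times the bound 3/2 on
`(1 + d) ^ k`; `hk` says exactly that `k * d ≤ 1/3`. -/
theorem sub_pow_mul_one_sub_pow_le {q k M s t : ℕ} (hk : 3 * (k * (k + 1)) + k ≤ q) (hq : 0 < q)
    (hqM : q ≤ M) (h1 : (1 - 1 / (M : ℝ)) ^ q ≤ 1 / 2)
    (h2 : 1 / 2 < (1 - 1 / ((M : ℝ) + 1)) ^ q) (hst : k ≤ s + t + 2) (hst' : s + t ≤ k) :
    ((M - s : ℕ) : ℝ) ^ q * (1 - (1 - 1 / ((M - s : ℕ) : ℝ)) ^ q) ^ t ≤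
      6 / 2 ^ k * (M : ℝ) ^ q := by
  have hkq : k < q := by
    rcases Nat.eq_zero_or_pos k with rfl | h
    · exact hq
    · have : 0 < k * (k + 1) := by positivity
      omega
  have hMs : ((M - s : ℕ) : ℝ) = M - s := Nat.cast_sub (by omega)
  have hqR : (0 : ℝ) < q := by exact_mod_cast hq
  have hqMR : (q : ℝ) ≤ M := by exact_mod_cast hqM
  have hM : (0 : ℝ) < M := by linarith
  have hsk : (s : ℝ) ≤ k := by exact_mod_cast (by omega : s ≤ k)
  have hkqR : (k : ℝ) + 1 ≤ q := by exact_mod_cast hkq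
  have hkR : 3 * ((k : ℝ) * (k + 1)) + k ≤ q := by exact_mod_cast hk
  have hs0 : (0 : ℝ) ≤ s := Nat.cast_nonneg _
  have hk0 : (0 : ℝ) ≤ k := Nat.cast_nonneg _
  have hMs0 : (1 : ℝ) ≤ M - s := by linarith
  rw [hMs]
  set y : ℝ := M - s with hy
  have hy0 : (0 : ℝ) < y := by linarith
  have hyq : y ^ q ≤ (1 / 2) ^ s * (M : ℝ) ^ q := by
    have hb := one_add_mul_le_pow (a := -(1 / (M : ℝ)))
      (by have : 1 / (M : ℝ) ≤ 1 := by (rw [div_le_one hM]; linarith)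
          linarith) s
    have hle : y ≤ (1 - 1 / (M : ℝ)) ^ s * M := by
      rw [← sub_eq_add_neg] at hb
      have := mul_le_mul_of_nonneg_right hb hM.le
      have e : (1 + (s : ℝ) * -(1 / M)) * M = y := by rw [hy]; field_simp; ring
      linarith
    calc y ^ q ≤ ((1 - 1 / (M : ℝ)) ^ s * M) ^ q := pow_le_pow_left₀ hy0.le hle q
      _ = ((1 - 1 / (M : ℝ)) ^ q) ^ s * M ^ q := by rw [mul_pow, ← pow_mul, ← pow_mul, mul_comm s]
      _ ≤ _ := by
        refine mul_le_mul_of_nonneg_right (pow_le_pow_left₀ (pow_nonneg ?_ q) h1 s) (by positivity)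
        rw [sub_nonneg, div_le_one hM]; linarith
  set d : ℝ := ((k : ℝ) + 1) / (q - k) with hd
  have hqk : (0 : ℝ) < q - k := by linarith
  have hd0 : 0 ≤ d := by positivity
  have hkd : (k : ℝ) * d ≤ 1 / 3 := by
    rw [hd, mul_div_assoc', div_le_iff₀ hqk]; linarith
  have hb0 : 0 ≤ 1 - (1 - 1 / y) ^ q := by
    have h0 : (0 : ℝ) ≤ 1 - 1 / y := by rw [sub_nonneg, div_le_one hy0]; exact hMs0
    have h0' : 1 - 1 / y ≤ 1 := by linarith [one_div_pos.2 hy0]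
    exact sub_nonneg.2 (pow_le_one₀ h0 h0')
  have hb : 1 - (1 - 1 / y) ^ q ≤ 1 / 2 * (1 + d) := by
    set x : ℝ := (s + 1) / (M * y) with hx
    have hMy : 0 < M * y := mul_pos hM hy0
    have hx1 : x ≤ 1 := by rw [hx, div_le_one hMy]; nlinarith
    -- Compares a palette of `y` colours with one of `M + 1`, where `h2` applies.
    have e : 1 - 1 / y = (1 - 1 / ((M : ℝ) + 1)) * (1 - x) := by
      have : (s : ℝ) = M - y := by rw [hy]; ring
      rw [hx, this]; field_simp; ring
    have hbern := one_add_mul_le_pow (a := -x) (by linarith) q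
    rw [← sub_eq_add_neg] at hbern
    have hqx : q * x ≤ d := by
      rw [hx, hd, mul_div_assoc', div_le_div_iff₀ hMy hqk]
      have a1 : (s : ℝ) + 1 ≤ k + 1 := by linarith
      have a2 : (q : ℝ) - k ≤ y := by linarith
      calc (q : ℝ) * (s + 1) * (q - k) ≤ M * (k + 1) * y := by gcongr
        _ = _ := by ring
    have hx0 : 0 ≤ (1 - x) ^ q := pow_nonneg (by linarith) q
    have h3 := mul_le_mul_of_nonneg_right h2.le hx0
    rw [e, mul_pow]
    linarith
  have hdk : (1 + d) ^ k ≤ 3 / 2 := by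
    rcases Nat.eq_zero_or_pos k with hk' | hk'
    · rw [hk', pow_zero]; norm_num
    have hk1 : (1 : ℝ) ≤ k := by exact_mod_cast hk'
    have hd1 : d ≤ 1 / 3 := by nlinarith
    have hbern := one_add_mul_le_pow (a := -d) (by linarith) k
    have hprod : (1 + d) ^ k * (1 + -d) ^ k ≤ 1 := by
      rw [← mul_pow]
      exact pow_le_one₀ (by nlinarith) (by nlinarith)
    have hpos : 0 < (1 + d) ^ k := by positivity
    have : (1 + d) ^ k * (2 / 3) ≤ (1 + d) ^ k * (1 + -d) ^ k :=
      mul_le_mul_of_nonneg_left (by linarith) hpos.le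
    linarith
  have hhalf : (1 / 2 : ℝ) ^ (s + t) ≤ 4 / 2 ^ k := by
    have : (1 / 2 : ℝ) ^ (s + t) = 4 * (1 / 2) ^ (s + t + 2) := by rw [pow_add _ (s + t)]; ring
    rw [this, div_eq_mul_one_div 4, ← one_div_pow]
    exact mul_le_mul_of_nonneg_left
      (pow_le_pow_of_le_one (by norm_num) (by norm_num) hst) (by norm_num)
  calc y ^ q * (1 - (1 - 1 / y) ^ q) ^ t
      ≤ ((1 / 2) ^ s * (M : ℝ) ^ q) * (1 / 2 * (1 + d)) ^ t :=
        mul_le_mul hyq (pow_le_pow_left₀ hb0 hb t) (pow_nonneg hb0 t) (by positivity)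
    _ = (1 / 2) ^ (s + t) * (1 + d) ^ t * (M : ℝ) ^ q := by rw [mul_pow, pow_add]; ring
    _ ≤ 4 / 2 ^ k * (3 / 2) * (M : ℝ) ^ q := by
        have : (1 + d) ^ t ≤ 3 / 2 :=
          (pow_le_pow_right₀ (by linarith) (by omega)).trans hdk
        gcongr
    _ = _ := by ring

open Filter in
theorem eventually_ceil_logb_quadratic_le : ∀ᶠ q : ℕ in atTop,
    3 * ((4 * ⌈Real.logb 2 (q : ℝ)⌉₊ + 4) * (4 * ⌈Real.logb 2 (q : ℝ)⌉₊ + 4 + 1)) +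
      (4 * ⌈Real.logb 2 (q : ℝ)⌉₊ + 4) ≤ q := by
  have h := ((Real.isLittleO_pow_log_id_atTop (n := 2)).comp_tendsto
    tendsto_natCast_atTop_atTop).bound (c := 1 / 1792) (by norm_num)
  -- With `k = 4m + 4 ≤ 16 log q`, the left side is `3k² + 4k ≤ 7k²`, and `1792 = 7 · 16²`.
  filter_upwards [h, eventually_ge_atTop 3] with q hq hq3
  simp only [Function.comp_apply, id, norm_pow, RCLike.norm_natCast, Real.norm_eq_abs, sq_abs] at hq
  have hq3R : (3 : ℝ) ≤ q := by exact_mod_cast hq3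
  have hlog1 : 1 ≤ Real.log q := by
    rw [Real.le_log_iff_exp_le (by linarith)]
    linarith [Real.exp_one_lt_d9]
  have hlogb : Real.logb 2 q ≤ 2 * Real.log q := by
    rw [Real.logb, div_le_iff₀ (Real.log_pos (by norm_num))]
    nlinarith [Real.log_two_gt_d9]
  have hceil := (Nat.ceil_lt_add_one (Real.logb_nonneg (b := 2) (by norm_num)
    (by linarith : (1 : ℝ) ≤ q))).le
  set m := ⌈Real.logb 2 (q : ℝ)⌉₊
  have hk : 4 * (m : ℝ) + 4 ≤ 16 * Real.log q := by linarith
  have hm : (0 : ℝ) ≤ m := Nat.cast_nonneg _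
  have : 3 * ((4 * (m : ℝ) + 4) * (4 * m + 4 + 1)) + (4 * m + 4) ≤ q := by nlinarith
  exact_mod_cast this

/-! ### Incidence graphs of projective planes. -/

namespace Configuration

variable {P : Type u} {L : Type v} [Membership P L] [ProjectivePlane P L]

theorem card_neighborFinset_incidenceGraph [Fintype P] [Fintype L]
    [DecidableRel (incidenceGraph P L).Adj] (x : P ⊕ L) :
    #((incidenceGraph P L).neighborFinset x) = ProjectivePlane.order P L + 1 := by
  classical
  rcases x with p | l
  · rw [← ProjectivePlane.lineCount_eq L p, lineCount, Nat.card_eq_fintype_card,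
      Fintype.card_subtype, ← card_map Function.Embedding.inr (s := ({l : L | p ∈ l} : Finset L))]
    refine congrArg card ?_
    ext (a | a) <;> rw [SimpleGraph.mem_neighborFinset] <;> simp [incidenceGraph]
  · rw [← ProjectivePlane.pointCount_eq P l, pointCount, Nat.card_eq_fintype_card,
      Fintype.card_subtype, ← card_map Function.Embedding.inl (s := ({p : P | p ∈ l} : Finset P))]
    refine congrArg card ?_
    ext (a | a) <;> rw [SimpleGraph.mem_neighborFinset] <;> simp [incidenceGraph]

/-- Distinct vertices of the incidence graph have at most one common neighbour. -/
theorem eq_of_adj_incidenceGraph {x y a b : P ⊕ L} (hxy : x ≠ y)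
    (hxa : (incidenceGraph P L).Adj x a) (hya : (incidenceGraph P L).Adj y a)
    (hxb : (incidenceGraph P L).Adj x b) (hyb : (incidenceGraph P L).Adj y b) : a = b := by
  rcases x with p | l <;> rcases y with p' | l' <;> rcases a with a | a <;> rcases b with b | b <;>
    simp only [incidenceGraph] at hxa hya hxb hyb
  · exact congrArg Sum.inr ((Nondegenerate.eq_or_eq hxa hya hxb hyb).resolve_left
      fun h => hxy (congrArg Sum.inl h))
  · exact congrArg Sum.inl ((Nondegenerate.eq_or_eq hxa hxb hya hyb).resolve_right
      fun h => hxy (congrArg Sum.inr h))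

theorem card_vertices_incidenceGraph [Fintype P] [Fintype L] :
    Fintype.card (P ⊕ L) =
      2 * (ProjectivePlane.order P L ^ 2 + ProjectivePlane.order P L + 1) := by
  rw [Fintype.card_sum, ProjectivePlane.card_points P L, ProjectivePlane.card_lines P L]
  ring

theorem exists_private_neighbors_incidenceGraph [Fintype P] [Fintype L] {x y : P ⊕ L}
    (hxy : x ≠ y) : ∃ (A : Finset (P ⊕ L)) (z : P ⊕ L),
      #A = ProjectivePlane.order P L ∧ z ∉ A ∧ (∀ u ∈ A, (incidenceGraph P L).Adj x u) ∧
      (∀ u ∈ A, ¬ (incidenceGraph P L).Adj y u) ∧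
      ∀ u, (incidenceGraph P L).Adj x u → u ∈ A ∨ u = z := by
  classical
  let N := (incidenceGraph P L).neighborFinset
  have hN : #(N x) = ProjectivePlane.order P L + 1 := card_neighborFinset_incidenceGraph x
  have hI : #(N x ∩ N y) ≤ 1 := by
    refine card_le_one.2 fun a ha b hb => ?_
    simp only [N, mem_inter, SimpleGraph.mem_neighborFinset] at ha hb
    exact eq_of_adj_incidenceGraph hxy ha.1 ha.2 hb.1 hb.2
  have hD := card_sdiff_add_card_inter (N x) (N y)
  obtain ⟨A, hAs, hA⟩ := exists_subset_card_eq
    (show ProjectivePlane.order P L ≤ #(N x \ N y) by omega)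
  have hAN : A ⊆ N x := hAs.trans sdiff_subset
  have hz : #(N x \ A) = 1 := by rw [card_sdiff_of_subset hAN]; omega
  obtain ⟨z, hz⟩ := card_eq_one.1 hz
  refine ⟨A, z, hA, ?_, ?_, ?_, ?_⟩
  · have : z ∈ N x \ A := by rw [hz]; exact mem_singleton_self z
    exact (mem_sdiff.1 this).2
  · exact fun u hu => by simpa [N] using hAN hu
  · exact fun u hu => by simpa [N] using (mem_sdiff.1 (hAs hu)).2
  · intro u hu
    by_cases huA : u ∈ A
    · exact Or.inl huA
    · have : u ∈ N x \ A := mem_sdiff.2 ⟨by simpa [N] using hu, huA⟩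
      rw [hz] at this
      exact Or.inr (mem_singleton.1 this)

theorem partitionDimension_incidenceGraph_le_card [Finite P] [Finite L] :
    (incidenceGraph P L).partitionDimension ≤
      2 * (ProjectivePlane.order P L ^ 2 + ProjectivePlane.order P L + 1) := by
  have := Fintype.ofFinite P
  have := Fintype.ofFinite L
  rw [← card_vertices_incidenceGraph]
  refine (incidenceGraph P L).partitionDimension_le_card_of_coloring id fun v w h => ?_
  have h1 := congrFun h v
  have h2 := (incidenceGraph P L).distToSet_lt_one_iff (v := v) (S := id ⁻¹' {v})
  simp only at h1
  rw [h1, SimpleGraph.distToSet_lt_one_iff] at h2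
  exact (h2.2 rfl).symm

variable (P L) in
theorem partitionDimension_incidenceGraph_le [Finite P] [Finite L]
    (hq8 : 8 ≤ ProjectivePlane.order P L)
    (hq : 3 * ((4 * ⌈Real.logb 2 (ProjectivePlane.order P L : ℝ)⌉₊ + 4) *
      (4 * ⌈Real.logb 2 (ProjectivePlane.order P L : ℝ)⌉₊ + 4 + 1)) +
      (4 * ⌈Real.logb 2 (ProjectivePlane.order P L : ℝ)⌉₊ + 4) ≤ ProjectivePlane.order P L) :
    (incidenceGraph P L).partitionDimension ≤
      4 * ⌈Real.logb 2 (ProjectivePlane.order P L : ℝ)⌉₊ + 5 := by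
  classical
  have := Fintype.ofFinite P
  have := Fintype.ofFinite L
  have hA := fun v w h => exists_private_neighbors_incidenceGraph (P := P) (L := L) (x := v)
    (y := w) h
  have hcard := card_vertices_incidenceGraph (P := P) (L := L)
  generalize ProjectivePlane.order P L = q at hA hq8 hq hcard ⊢
  obtain ⟨M, hqM, h1, h2⟩ := exists_nat_half_between (q := q) (by omega)
  have hq8R : (8 : ℝ) ≤ q := by exact_mod_cast hq8
  have hpow : (q : ℝ) ≤ 2 ^ ⌈Real.logb 2 (q : ℝ)⌉₊ := by
    have := Nat.le_ceil (Real.logb 2 (q : ℝ))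
    rwa [Real.logb_le_iff_le_rpow (by norm_num) (by linarith), Real.rpow_natCast] at this
  generalize ⌈Real.logb 2 (q : ℝ)⌉₊ = m at hq hpow ⊢
  refine (incidenceGraph P L).partitionDimension_le_of_first_moment (k := 4 * m + 4) (M := M)
    (c := 6 / 2 ^ (4 * m + 4)) (by nlinarith)
    (fun s t hst hst' => sub_pow_mul_one_sub_pow_le hq (by omega) hqM h1 h2 hst hst') hA ?_
  have h2k : 16 * (q : ℝ) ^ 4 ≤ 2 ^ (4 * m + 4) := by
    have := pow_le_pow_left₀ (by linarith) hpow 4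
    rw [pow_add, mul_comm 4 m, pow_mul]
    linarith
  have hq4 : (0 : ℝ) < (q : ℝ) ^ 4 := by positivity
  rw [hcard, mul_div_assoc', div_lt_iff₀ (by positivity)]
  push_cast
  -- This uses `q ≥ 8`; 23/20 is small enough because `4 · (23/20)² · 6/16 < 2`.
  have hb : (q : ℝ) ^ 2 + q + 1 ≤ 23 / 20 * q ^ 2 := by nlinarith
  have hb2 := pow_le_pow_left₀ (by positivity) hb 2
  nlinarith

end Configuration

theorem theorem3 :
    (∃ ε : ℕ → ℝ, Filter.Tendsto ε Filter.atTop (nhds 0) ∧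
      ∀ (P : Type u) (L : Type v) [Membership P L] [Configuration.ProjectivePlane P L]
        [Finite P] [Finite L],
        ((Configuration.incidenceGraph P L).partitionDimension : ℝ) ≤
          (4 + ε (Configuration.ProjectivePlane.order P L)) *
            Real.logb 2 (Configuration.ProjectivePlane.order P L : ℝ)) ∧
    (∃ q₀ : ℕ, ∀ (P : Type u) (L : Type v) [Membership P L] [Configuration.ProjectivePlane P L]
        [Finite P] [Finite L],
        q₀ ≤ Configuration.ProjectivePlane.order P L →
          (Configuration.incidenceGraph P L).partitionDimension ≤
            4 * ⌈Real.logb 2 (Configuration.ProjectivePlane.order P L : ℝ)⌉₊ + 5) := by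
  obtain ⟨q₀, hq₀⟩ := Filter.eventually_atTop.1
    (eventually_ceil_logb_quadratic_le.and (Filter.eventually_ge_atTop 8))
  have hbound : ∀ (P : Type u) (L : Type v) [Membership P L] [Configuration.ProjectivePlane P L]
      [Finite P] [Finite L], q₀ ≤ Configuration.ProjectivePlane.order P L →
        (Configuration.incidenceGraph P L).partitionDimension ≤
          4 * ⌈Real.logb 2 (Configuration.ProjectivePlane.order P L : ℝ)⌉₊ + 5 := by
    intro P L _ _ _ _ h
    exact Configuration.partitionDimension_incidenceGraph_le P L (hq₀ _ h).2 (hq₀ _ h).1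
  -- The 9 is 5 plus 4 for rounding the logarithm up; for small `q` the number of vertices suffices
  -- because `log₂ q ≥ 1`.
  refine ⟨⟨fun q => if q₀ ≤ q then 9 / Real.logb 2 q else 2 * ((q : ℝ) ^ 2 + q + 1), ?_, ?_⟩,
    q₀, hbound⟩
  · have hlog : Filter.Tendsto (fun q : ℕ => 9 / Real.logb 2 (q : ℝ)) Filter.atTop (nhds 0) :=
      ((Real.tendsto_logb_atTop (by norm_num)).comp tendsto_natCast_atTop_atTop).const_div_atTop 9
    refine hlog.congr' ?_
    filter_upwards [Filter.eventually_ge_atTop q₀] with q hq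
    rw [if_pos hq]
  · intro P L _ _ _ _
    have hq2 := Configuration.ProjectivePlane.one_lt_order P L
    have h1 := hbound P L
    have h2 := Configuration.partitionDimension_incidenceGraph_le_card (P := P) (L := L)
    generalize Configuration.ProjectivePlane.order P L = q at hq2 h1 h2 ⊢
    have hq2R : (2 : ℝ) ≤ q := by exact_mod_cast hq2
    have hlog : 1 ≤ Real.logb 2 q := by
      rw [Real.le_logb_iff_rpow_le (by norm_num) (by linarith), Real.rpow_one]
      exact hq2R
    beta_reduce
    split_ifs with hq
    · have h3 := (Nat.cast_le (α := ℝ)).2 (h1 hq)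
      push_cast at h3
      have hceil := (Nat.ceil_lt_add_one (zero_le_one.trans hlog)).le
      rw [add_mul, div_mul_cancel₀ _ (by linarith)]
      linarith
    · have h3 := (Nat.cast_le (α := ℝ)).2 h2
      push_cast at h3
      have : (0 : ℝ) ≤ 2 * ((q : ℝ) ^ 2 + q + 1) := by positivity
      nlinarith
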